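/- **Setting.** Let $p\neq 2$ be a prime, $F$ a finite extension of $\mathbb{Q}_p$, $E/F$ a quadratic extension with nontrivial automorphism $\tau$, and $\psi$ a nontrivial continuous unitary character of $F$. Let $(V,h)$ be an $\epsilon$-hermitian and $(V',h')$ an $\epsilon'$-hermitian space over $E$ (finite-dimensional, nondegenerate), $\epsilon,\epsilon'\in\{\pm1\}$, $\epsilon\epsilon'=-1$, with unitary groups $\mathrm{U}(V)$, $\mathrm{U}(V')$. Let $W=V\otimes_E V'$ be the symplectic $F$-space with $$\langle v_1\otimes v_1',v_2\otimes v_2'\rangle=\tfrac12\mathrm{Tr}_{E/F}\bigl(h(v_1,v_2)\,\tau(h'(v_1',v_2'))\bigr),$$ let $\iota_{V'}\colon \mathrm{U}(V)\to\mathrm{Sp}(W)$, $g\mapsto g\otimes\mathrm{id}$, and $\iota_V\colon \mathrm{U}(V')\to\mathrm{Sp}(W)$, $g'\mapsto\mathrm{id}\otimes g'$, and let $\mathbb{H}(W)=W\times F$ be the Heisenberg group, with product $(w_1,t_1)(w_2,t_2)=(w_1+w_2,\,t_1+t_2+\frac12\langle w_1,w_2\rangle)$. A *model* is an irreducible smooth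 complex representation $(\rho,\mathcal S)$ of $\mathbb{H}(W)$ with central character $\psi$. It defines $$\mathrm{Mp}(W)=\{(g,M)\in\mathrm{Sp}(W)\times\mathrm{GL}(\mathcal S)\mid M\rho(w,t)=\rho(gw,t)M\ \text{for all }(w,t)\},$$ topologized as a subspace, where $\mathrm{GL}(\mathcal S)$ has the topology of pointwise convergence for the discrete topology on $\mathcal S$; its Weil representation $\omega(g,M)=M$; and the covers $\widetilde{\mathrm{U}(V)}$, $\widetilde{\mathrm{U}(V')}$, the preimages in $\mathrm{Mp}(W)$ of $\iota_{V'}(\mathrm{U}(V))$ and $\iota_V(\mathrm{U}(V'))$. Irreducible admissible representations $\widetilde\pi$ of $\widetilde{\mathrm{U}(V)}$ and $\widetilde\pi'$ of $\widetilde{\mathrm{U}(V')}$ *correspond* if the maximal $\widetilde\pi$-isotypic quotient of $\omega$ is isomorphic to $\widetilde\pi\boxtimes\Theta$ for a representation $\Theta$ of $\widetilde{\mathrm{U}(V')}$ whose unique irreducible quotient is $\widetilde\pi'$. Given $M_g\in\mathrm{GL}(\mathcal S)$ with $(g,M_g)\in\mathrm{Mp}(W)$ for every $g\in\mathrm{Sp}(W)$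 and $M_1=\mathrm{id}$, a function $\beta\colon\mathrm{U}(V)\to\mathbb{C}^\times$ is a *splitting* if $M_{\iota_{V'}(g)}M_{\iota_{V'}(g')}M_{\iota_{V'}(gg')}^{-1}=\beta(gg')\beta(g)^{-1}\beta(g')^{-1}$ for all $g,g'\in\mathrm{U}(V)$, so that $\widetilde\beta(g)=(\iota_{V'}(g),\beta(g)M_{\iota_{V'}(g)})$ is a homomorphism $\mathrm{U}(V)\to\widetilde{\mathrm{U}(V)}$. It is *admissible* if the pullback along $\widetilde\beta$ of every admissible representation is admissible; similarly for $\mathrm{U}(V')$. Given splittings over $\mathrm{U}(V)$ and $\mathrm{U}(V')$, irreducible admissible representations $\pi$ of $\mathrm{U}(V)$ and $\pi'$ of $\mathrm{U}(V')$ are *related* with respect to them if their extensions to the covers (along the splittings, a scalar $z\in\mathbb{C}^\times$ acting by $z$) correspond. **Statement.** Let $(\rho^Y,\mathcal S^Y)$ and $(\rho^B,\mathcal S^B)$ be two models with choices of operators $M^Y_g$ and $M^B_g$ as above, and let $\Psi\colon\mathcal S^Y\to\mathcal S^B$ be an isomorphism of representations of $\mathbb{H}(W)$. Let $\beta^Y_{V'},\beta^Y_V$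 be admissible splittings over $\mathrm{U}(V)$ and $\mathrm{U}(V')$ for $M^Y$, and let $\beta^{L}_{V'},\beta^{L'}_{V}$ be admissible splittings over $\mathrm{U}(V)$ and $\mathrm{U}(V')$ for $M^B$. (For instance: the Schrödinger model with Kudla's splittings, and the generalized lattice model with Pan's splittings.) Let $\pi$ and $\pi'$ be irreducible admissible representations of $\mathrm{U}(V)$ and $\mathrm{U}(V')$ that are related with respect to $\beta^L_{V'}$ and $\beta^{L'}_V$. Then there are functions $\alpha_{V'}\colon\mathrm{U}(V)\to\mathbb{C}^\times$ and $\alpha_V\colon\mathrm{U}(V')\to\mathbb{C}^\times$ (obviously unique) with $$\alpha_{V'}(g)\,M^B_{\iota_{V'}(g)}\circ\Psi=\Psi\circ M^Y_{\iota_{V'}(g)},\qquad \alpha_{V}(g')\,M^B_{\iota_{V}(g')}\circ\Psi=\Psi\circ M^Y_{\iota_{V}(g')},$$ the ratios $$\xi_{V'}=\alpha_{V'}\beta^Y_{V'}(\beta^L_{V'})^{-1},\qquad \xi_V=\alpha_V\beta^Y_V(\beta^{L'}_V)^{-1}$$ are continuous characters of $\mathrm{U}(V)$ and $\mathrm{U}(V')$,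 and $\pi\otimes\xi_{V'}$ and $\pi'\otimes\xi_V$ are related with respect to $\beta^Y_{V'}$ and $\beta^Y_V$. -/

import Mathlib

open scoped TensorProduct

universe u

namespace LocalTheta

noncomputable section

/-! ## Smooth and admissible representations -/

section Reps

variable {G : Type*} [Group G] [TopologicalSpace G]
variable {U : Type*} [AddCommGroup U] [Module ℂ U]

/-- A complex representation is smooth if every vector has an open stabilizer. -/
def IsSmooth (π : Representation ℂ G U) : Prop :=
  ∀ v : U, IsOpen {g : G | π g v = v}

/-- A representation is admissible if it is smooth and every compact open subgroup has a
finite-dimensional space of fixed vectors. -/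
structure IsAdmissible (π : Representation ℂ G U) : Prop where
  smooth : IsSmooth π
  finite : ∀ K : Subgroup G, IsOpen (K : Set G) → IsCompact (K : Set G) →
    FiniteDimensional ℂ (Representation.invariants (MonoidHom.comp π K.subtype))

/-- Irreducible admissible representations. -/
structure IsIrreducibleAdmissible (π : Representation ℂ G U) : Prop where
  irreducible : π.IsIrreducible
  admissible : IsAdmissible π

end Reps

/-- The twist `π ⊗ ξ` of a representation by a character. -/
def twist {G : Type*} [Group G] {U : Type*} [AddCommGroup U] [Module ℂ U]
    (π : Representation ℂ G U) (ξ : G →* ℂˣ) : Representation ℂ G U where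
  toFun g := (ξ g : ℂ) • π g
  map_one' := by simp
  map_mul' g g' := by
    ext v
    simp [mul_smul, smul_comm (ξ g : ℂ)]

/-! ## Isometry groups: symplectic and unitary groups -/

section Isometry

variable (K : Type*) {M N : Type*} [CommRing K] [AddCommGroup M] [Module K M]

/-- The group of `K`-linear automorphisms of `M` that preserve `B : M × M → N`. -/
def isometryGroup (B : M → M → N) : Subgroup (M ≃ₗ[K] M) where
  carrier := {g | ∀ x y, B (g x) (g y) = B x y}
  one_mem' := fun _ _ => rfl
  mul_mem' := fun {a b} ha hb x y => by
    rw [LinearEquiv.mul_apply, LinearEquiv.mul_apply, ha, hb]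
  inv_mem' := fun {a} ha x y => by
    have h := ha (a⁻¹ x) (a⁻¹ y)
    rw [← LinearEquiv.mul_apply, ← LinearEquiv.mul_apply, mul_inv_cancel] at h
    exact h.symm

/-- The topology on an isometry group, as a subspace of `End_K(M)`; the latter carries its
module topology, which is the usual topology when `M` is finite-dimensional over a
`p`-adic field `K`. -/
instance isometryGroupTopology [TopologicalSpace K] (B : M → M → N) :
    TopologicalSpace (isometryGroup K B) :=
  TopologicalSpace.induced (fun g => ((g : M ≃ₗ[K] M) : M →ₗ[K] M))
    (moduleTopology K (M →ₗ[K] M))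

end Isometry

/-! ## The Heisenberg group, the metaplectic cover and the Weil representation -/

section Heisenberg

variable {F W : Type*} [Field F] [AddCommGroup W] [Module F W]

/-- The symplectic group of `(W, B)`. -/
abbrev Sp (B : LinearMap.BilinForm F W) : Subgroup (W ≃ₗ[F] W) :=
  isometryGroup F (fun x y => B x y)

/-- The Heisenberg group `ℍ(W) = W × F`. -/
@[ext]
structure Heisenberg (B : LinearMap.BilinForm F W) where
  vec : W
  scal : F

variable {B : LinearMap.BilinForm F W}

/-- `(w₁, t₁) (w₂, t₂) = (w₁ + w₂, t₁ + t₂ + ⟨w₁, w₂⟩ / 2)`. For alternating `B` the inverse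
of `(w, t)` is `(-w, -t)`; the formula below is the inverse for every bilinear form. -/
instance : Group (Heisenberg B) where
  mul a b := ⟨a.vec + b.vec, a.scal + b.scal + (2 : F)⁻¹ * B a.vec b.vec⟩
  one := ⟨0, 0⟩
  inv a := ⟨-a.vec, -a.scal + (2 : F)⁻¹ * B a.vec a.vec⟩
  mul_assoc a b c := by
    apply Heisenberg.ext
    · exact add_assoc _ _ _
    · change a.scal + b.scal + (2 : F)⁻¹ * B a.vec b.vec + c.scal
          + (2 : F)⁻¹ * B (a.vec + b.vec) c.vec
        = a.scal + (b.scal + c.scal + (2 : F)⁻¹ * B b.vec c.vec)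
          + (2 : F)⁻¹ * B a.vec (b.vec + c.vec)
      simp only [map_add, LinearMap.add_apply]
      ring
  one_mul a := by
    apply Heisenberg.ext
    · exact zero_add _
    · change 0 + a.scal + (2 : F)⁻¹ * B 0 a.vec = a.scal
      simp
  mul_one a := by
    apply Heisenberg.ext
    · exact add_zero _
    · change a.scal + 0 + (2 : F)⁻¹ * B a.vec 0 = a.scal
      simp
  inv_mul_cancel a := by
    apply Heisenberg.ext
    · exact neg_add_cancel _
    · change -a.scal + (2 : F)⁻¹ * B a.vec a.vec + a.scal + (2 : F)⁻¹ * B (-a.vec) a.vec = 0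
      simp only [map_neg, LinearMap.neg_apply]
      ring

/-- The product topology on `W × F`, with the module topology on `W`. -/
instance [TopologicalSpace F] : TopologicalSpace (Heisenberg B) :=
  letI : TopologicalSpace W := moduleTopology F W
  TopologicalSpace.induced (fun a => (a.vec, a.scal)) inferInstance

variable {S : Type*} [AddCommGroup S] [Module ℂ S]

/-- `ρ` is a realization of `ρ_ψ`: an irreducible smooth representation of the Heisenberg
group with central character `ψ`. -/
structure IsHeisenbergModel [TopologicalSpace F] (ψ : AddChar F Circle)
    (ρ : Representation ℂ (Heisenberg B) S) : Prop where
  irreducible : ρ.IsIrreducible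
  smooth : IsSmooth ρ
  central : ∀ (t : F) (φ : S), ρ ⟨0, t⟩ φ = (ψ t : ℂ) • φ

/-- The metaplectic cover `Mp(W)`: the pairs `(g, M)` with `g ∈ Sp(W)`, `M ∈ GL(S)` and
`M ∘ ρ(w, t) = ρ(g w, t) ∘ M` for all `(w, t)`. -/
def Mp (ρ : Representation ℂ (Heisenberg B) S) : Subgroup (Sp B × (S ≃ₗ[ℂ] S)) where
  carrier := {x | ∀ (a : Heisenberg B) (φ : S),
    x.2 (ρ a φ) = ρ ⟨(x.1 : W ≃ₗ[F] W) a.vec, a.scal⟩ (x.2 φ)}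
  one_mem' := fun _ _ => rfl
  mul_mem' := fun {x y} hx hy a φ => by
    change x.2 (y.2 (ρ a φ)) = ρ ⟨x.1.1 (y.1.1 a.vec), a.scal⟩ (x.2 (y.2 φ))
    rw [hy, hx]
  inv_mem' := fun {x} hx a φ => by
    change x.2.symm (ρ a φ) = ρ ⟨x.1.1.symm a.vec, a.scal⟩ (x.2.symm φ)
    rw [LinearEquiv.symm_apply_eq, hx]
    simp

/-- The topology on `Mp(W)` as a subspace of `Sp(W) × GL(S)`, where `GL(S)` has the topology
of pointwise convergence on the discrete space `S`. -/
instance [TopologicalSpace F] (ρ : Representation ℂ (Heisenberg B) S) :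
    TopologicalSpace (Mp ρ) :=
  TopologicalSpace.induced (fun x => x.1.1) inferInstance ⊓
    ⨅ φ : S, TopologicalSpace.induced (fun x => x.1.2 φ) ⊥

/-- The projection `Mp(W) → Sp(W)`. -/
def Mp.proj (ρ : Representation ℂ (Heisenberg B) S) : Mp ρ →* Sp B :=
  (MonoidHom.fst _ _).comp (Mp ρ).subtype

/-- The Weil representation `(g, M) ↦ M` of `Mp(W)`. -/
def weil (ρ : Representation ℂ (Heisenberg B) S) : Representation ℂ (Mp ρ) S where
  toFun x := (x.1.2 : S →ₗ[ℂ] S)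
  map_one' := rfl
  map_mul' _ _ := rfl

/-- The cover of `G` attached to `ι : G → Sp(W)`: the preimage of `ι(G)` in `Mp(W)`. -/
def cover (ρ : Representation ℂ (Heisenberg B) S) {G : Type*} [Group G] (ι : G →* Sp B) :
    Subgroup (Mp ρ) :=
  ι.range.comap (Mp.proj ρ)

/-! ## Theta correspondence for subgroups of the metaplectic cover -/

section Theta

variable {ρ : Representation ℂ (Heisenberg B) S} {H H' : Subgroup (Mp ρ)}
variable {U U' T : Type*} [AddCommGroup U] [Module ℂ U] [AddCommGroup U'] [Module ℂ U']
  [AddCommGroup T] [Module ℂ T]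

/-- The intersection of the kernels of all `H`-equivariant maps from the Weil representation
to `π`; the quotient of `S` by it is the maximal `π`-isotypic quotient. -/
def isotypicKernel (π : Representation ℂ H U) : Submodule ℂ S :=
  ⨅ f : {f : S →ₗ[ℂ] U // ∀ (x : H) (φ : S), f (weil ρ x φ) = π x (f φ)},
    LinearMap.ker f.1

/-- `Θ` is the big theta lift of `π`: the maximal `π`-isotypic quotient of the Weil
representation, with its actions of `H` and `H'`, is isomorphic to `π ⊠ Θ`. -/
def IsBigTheta (π : Representation ℂ H U) (Θ : Representation ℂ H' T) : Prop :=
  ∃ q : S →ₗ[ℂ] U ⊗[ℂ] T,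
    Function.Surjective q ∧ LinearMap.ker q = isotypicKernel π ∧
    (∀ (x : H) (φ : S), q (weil ρ x φ) = TensorProduct.map (π x) LinearMap.id (q φ)) ∧
    (∀ (y : H') (φ : S), q (weil ρ y φ) = TensorProduct.map LinearMap.id (Θ y) (q φ))

/-- `σ` is (isomorphic to) the unique irreducible quotient of `Θ`: `σ` is irreducible, it is a
quotient of `Θ`, and the kernel is the only maximal proper subrepresentation of `Θ`. -/
def IsUniqueIrreducibleQuotient (Θ : Representation ℂ H' T) (σ : Representation ℂ H' U') :
    Prop :=
  σ.IsIrreducible ∧ ∃ r : Representation.IntertwiningMap Θ σ,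
    Function.Surjective r ∧ ∀ N : Subrepresentation Θ, IsCoatom N → N = r.ker

end Theta

/-- The local theta correspondence for `H` and `H'`: `π` and `π'` are irreducible admissible,
and `π'` is the small theta lift of `π`, that is, the unique irreducible quotient of the big
theta lift of `π`. -/
def ThetaCorrespond [TopologicalSpace F] {ρ : Representation ℂ (Heisenberg B) S}
    {H H' : Subgroup (Mp ρ)} {U U' : Type u} [AddCommGroup U] [Module ℂ U]
    [AddCommGroup U'] [Module ℂ U'] (π : Representation ℂ H U)
    (π' : Representation ℂ H' U') : Prop :=
  IsIrreducibleAdmissible π ∧ IsIrreducibleAdmissible π' ∧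
    ∃ (T : Type u) (_ : AddCommGroup T) (_ : Module ℂ T) (Θ : Representation ℂ H' T),
      IsBigTheta π Θ ∧ IsUniqueIrreducibleQuotient Θ π'

/-! ## Splittings -/

/-- Multiplication by a nonzero scalar, as an element of `GL(S)`. -/
def scalarAut (S : Type*) [AddCommGroup S] [Module ℂ S] : ℂˣ →* (S ≃ₗ[ℂ] S) :=
  DistribMulAction.toModuleAut ℂ S

/-- A choice of `M_g ∈ GL(S)` with `(g, M_g) ∈ Mp(W)` for each `g ∈ Sp(W)`, such that
`M_1 = id`. -/
structure OperatorChoice (ρ : Representation ℂ (Heisenberg B) S) where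
  op : Sp B → (S ≃ₗ[ℂ] S)
  op_one : op 1 = 1
  mem : ∀ g : Sp B, (g, op g) ∈ Mp ρ

variable {ρ : Representation ℂ (Heisenberg B) S} {G : Type*} [Group G]

/-- `β` is a splitting over `G` of the cocycle `c(g, g') = M_g M_{g'} M_{gg'}⁻¹`:
`c(g, g') = β(gg') β(g)⁻¹ β(g')⁻¹` for all `g, g' ∈ G`. -/
def IsSplitting (M : OperatorChoice ρ) (ι : G →* Sp B) (β : G → ℂˣ) : Prop :=
  ∀ g g' : G, M.op (ι g) * M.op (ι g') * (M.op (ι g * ι g'))⁻¹ =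
    scalarAut S (β (g * g') * (β g)⁻¹ * (β g')⁻¹)

/-- Scalars times elements of `Mp(W)` lie in `Mp(W)`. -/
theorem scalar_mem_Mp (M : OperatorChoice ρ) (g : Sp B) (z : ℂˣ) :
    (g, scalarAut S z * M.op g) ∈ Mp ρ := by
  intro a φ
  change (z : ℂ) • M.op g (ρ a φ) =
    ρ ⟨(g : W ≃ₗ[F] W) a.vec, a.scal⟩ ((z : ℂ) • M.op g φ)
  rw [map_smul]
  exact congrArg _ (M.mem g a φ)

/-- The element `(ι(g), z β(g) M_{ι(g)})` of the cover of `G`. -/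
def coverElt (M : OperatorChoice ρ) (ι : G →* Sp B) (β : G → ℂˣ) (g : G) (z : ℂˣ) :
    cover ρ ι :=
  ⟨⟨(ι g, scalarAut S (z * β g) * M.op (ι g)), scalar_mem_Mp M (ι g) (z * β g)⟩, ⟨g, rfl⟩⟩

/-- The homomorphism `g ↦ (ι(g), β(g) M_{ι(g)})` from `G` to its cover. -/
def liftHom {M : OperatorChoice ρ} {ι : G →* Sp B} {β : G → ℂˣ} (h : IsSplitting M ι β) :
    G →* cover ρ ι :=
  MonoidHom.mk' (fun g => coverElt M ι β g 1) (by
    intro g g'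
    apply Subtype.ext
    apply Subtype.ext
    apply Prod.ext
    · exact map_mul ι g g'
    · change scalarAut S (1 * β (g * g')) * M.op (ι (g * g')) =
        scalarAut S (1 * β g) * M.op (ι g) * (scalarAut S (1 * β g') * M.op (ι g'))
      have hc : ∀ (z : ℂˣ) (A : S ≃ₗ[ℂ] S), A * scalarAut S z = scalarAut S z * A := by
        intro z A
        ext φ
        exact map_smul A (z : ℂ) φ
      have h1 := h g g'
      rw [mul_inv_eq_iff_eq_mul] at h1
      rw [one_mul, one_mul, one_mul, mul_assoc, ← mul_assoc (M.op (ι g)), hc, mul_assoc, h1,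
        map_mul ι, ← mul_assoc, ← mul_assoc, ← map_mul, ← map_mul]
      congr 2
      rw [mul_assoc (β (g * g')), ← mul_inv, mul_comm (β (g * g')), ← map_mul, mul_inv_cancel_left])

/-- A splitting is admissible if the pullback of every admissible representation of the cover
of `G` is an admissible representation of `G`. -/
def IsAdmissibleSplitting [TopologicalSpace F] [TopologicalSpace G] (M : OperatorChoice ρ)
    (ι : G →* Sp B) (β : G → ℂˣ) : Prop :=
  ∃ h : IsSplitting M ι β,
    ∀ (U : Type u) [AddCommGroup U] [Module ℂ U] (σ : Representation ℂ (cover ρ ι) U),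
      IsAdmissible σ → IsAdmissible (MonoidHom.comp σ (liftHom h))

/-- `σ` is the extension of `π` to the cover of `G` via `β`: the element
`(ι(g), z β(g) M_{ι(g)})` acts by `z π(g)`. -/
def IsExtension (M : OperatorChoice ρ) (ι : G →* Sp B) (β : G → ℂˣ) {U : Type*}
    [AddCommGroup U] [Module ℂ U] (π : Representation ℂ G U)
    (σ : Representation ℂ (cover ρ ι) U) : Prop :=
  ∀ (g : G) (z : ℂˣ), σ (coverElt M ι β g z) = (z : ℂ) • π g

/-- `π` and `π'` are related under the local theta correspondence for `G` and `G'` with respect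
to `β` and `β'`: they are irreducible admissible, and their extensions to the covers via `β`
and `β'` correspond. -/
def ThetaRelated [TopologicalSpace F] [TopologicalSpace G] {G' : Type*} [Group G']
    [TopologicalSpace G'] (M : OperatorChoice ρ) (ι : G →* Sp B) (ι' : G' →* Sp B)
    (β : G → ℂˣ) (β' : G' → ℂˣ) {U U' : Type u} [AddCommGroup U] [Module ℂ U]
    [AddCommGroup U'] [Module ℂ U'] (π : Representation ℂ G U)
    (π' : Representation ℂ G' U') : Prop :=
  IsIrreducibleAdmissible π ∧ IsIrreducibleAdmissible π' ∧
    ∃ (σ : Representation ℂ (cover ρ ι) U) (σ' : Representation ℂ (cover ρ ι') U'),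
      IsExtension M ι β π σ ∧ IsExtension M ι' β' π' σ' ∧ ThetaCorrespond σ σ'

/-- `α` compares two choices of operators through the isomorphism `Ψ` of the two models:
`α(g) · M^B_{ι(g)} ∘ Ψ = Ψ ∘ M^Y_{ι(g)}`. -/
def IsComparison {S₂ : Type*} [AddCommGroup S₂] [Module ℂ S₂]
    {ρ₂ : Representation ℂ (Heisenberg B) S₂} (MY : OperatorChoice ρ) (MB : OperatorChoice ρ₂)
    (Ψ : Representation.Equiv ρ ρ₂) (ι : G →* Sp B) (α : G → ℂˣ) : Prop :=
  ∀ (g : G) (φ : S), (α g : ℂ) • MB.op (ι g) (Ψ φ) = Ψ (MY.op (ι g) φ)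

end Heisenberg

/-! ## Hermitian spaces and the dual pair -/

section DualPair

variable {F E : Type*} [Field F] [Field E] [Algebra F E] {τ : E ≃ₐ[F] E}
variable {V V' : Type*} [AddCommGroup V] [Module E V] [AddCommGroup V'] [Module E V']

/-- `h` is `ε`-hermitian, `h(v, w) = ε τ(h(w, v))`, and nondegenerate. (The semilinearity of `h`
is part of its type wherever this is used.) -/
structure IsHermitian (τ : E ≃ₐ[F] E) (ε : ℤˣ) (h : V → V → E) : Prop where
  symm : ∀ v w, h v w = ((ε : ℤ) : E) * τ (h w v)
  nondegenerate : ∀ v, (∀ w, h v w = 0) → v = 0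

/-- The `E`-valued form `(v₁ ⊗ v₁', v₂ ⊗ v₂') ↦ h(v₁, v₂) τ(h'(v₁', v₂'))` on `V ⊗ V'`. -/
def tensorSesq (h : V →ₛₗ[(τ : E →+* E)] V →ₗ[E] E)
    (h' : V' →ₗ[E] V' →ₛₗ[(τ : E →+* E)] E) (hτ : ∀ x, τ (τ x) = x) :
    (V ⊗[E] V') →ₛₗ[(τ : E →+* E)] (V ⊗[E] V') →ₗ[E] E :=
  (TensorProduct.map₂ h
    (LinearMap.mk₂'ₛₗ (τ : E →+* E) (RingHom.id E) (fun v w => τ (h' v w))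
      (by simp) (by simp) (by simp) (by simp [hτ]))).compr₂ₛₗ
    (LinearMap.mul' E E)

/-- The form `⟨v₁ ⊗ v₁', v₂ ⊗ v₂'⟩ = ½ Tr_{E/F} (h(v₁, v₂) τ(h'(v₁', v₂')))` on `V ⊗ V'`,
regarded as an `F`-space. -/
def dualPairForm [Module F V] [IsScalarTower F E V] (h : V →ₛₗ[(τ : E →+* E)] V →ₗ[E] E)
    (h' : V' →ₗ[E] V' →ₛₗ[(τ : E →+* E)] E) (hτ : ∀ x, τ (τ x) = x) :
    LinearMap.BilinForm F (V ⊗[E] V') :=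
  LinearMap.mk₂ F
    (fun x y => (2 : F)⁻¹ * Algebra.trace F E (tensorSesq h h' hτ x y))
    (by intros; simp [mul_add])
    (by
      intro c x y
      rw [← algebraMap_smul E c x, LinearMap.map_smulₛₗ, LinearMap.smul_apply]
      simp [← Algebra.smul_def]
      ring)
    (by intros; simp [mul_add])
    (by
      intro c x y
      rw [← algebraMap_smul E c y, map_smul]
      simp [← Algebra.smul_def]
      ring)

theorem dualPairForm_tmul [Module F V] [IsScalarTower F E V]
    (h : V →ₛₗ[(τ : E →+* E)] V →ₗ[E] E) (h' : V' →ₗ[E] V' →ₛₗ[(τ : E →+* E)] E)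
    (hτ : ∀ x, τ (τ x) = x) (v₁ v₂ : V) (v₁' v₂' : V') :
    dualPairForm h h' hτ (v₁ ⊗ₜ v₁') (v₂ ⊗ₜ v₂') =
      (2 : F)⁻¹ * Algebra.trace F E (h v₁ v₂ * τ (h' v₁' v₂')) := rfl

/-- An automorphism of a quadratic extension is an involution. -/
theorem involution_of_quadratic (hE : Module.finrank F E = 2) (τ : E ≃ₐ[F] E) (x : E) :
    τ (τ x) = x := by
  have : FiniteDimensional F E := Module.finite_of_finrank_pos (by omega)
  have hcard : Fintype.card (E ≃ₐ[F] E) ≤ 2 := hE ▸ AlgEquiv.card_le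
  have hpos : 0 < Fintype.card (E ≃ₐ[F] E) := Fintype.card_pos
  have h1 : τ ^ Fintype.card (E ≃ₐ[F] E) = 1 := pow_card_eq_one
  have h2 : τ ^ 2 = 1 := by
    interval_cases hc : Fintype.card (E ≃ₐ[F] E)
    · rw [pow_one] at h1
      rw [h1, one_pow]
    · exact h1
  have h3 := DFunLike.congr_fun h2 x
  rwa [pow_two] at h3

/-- The unitary group `U(V)` of a space with an `E`-valued form. -/
abbrev UnitaryGroup (E : Type*) [Field E] {V : Type*} [AddCommGroup V] [Module E V]
    (h : V → V → E) : Subgroup (V ≃ₗ[E] V) :=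
  isometryGroup E h

section Embeddings

variable [Module F V] [IsScalarTower F E V]

/-- The tensor product of two `E`-linear automorphisms, as an `F`-linear automorphism. -/
def tensorAut (F : Type*) [Field F] [Algebra F E] [Module F V] [IsScalarTower F E V]
    (a : V ≃ₗ[E] V) (b : V' ≃ₗ[E] V') : (V ⊗[E] V') ≃ₗ[F] (V ⊗[E] V') :=
  (TensorProduct.congr a b).restrictScalars F

theorem tensorAut_tmul (a : V ≃ₗ[E] V) (b : V' ≃ₗ[E] V') (v : V) (v' : V') :
    tensorAut F a b (v ⊗ₜ v') = a v ⊗ₜ b v' := rfl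

theorem tensorAut_one :
    tensorAut F (1 : V ≃ₗ[E] V) (1 : V' ≃ₗ[E] V') = 1 := by
  apply LinearEquiv.ext
  intro x
  induction x using TensorProduct.induction_on with
  | zero => rw [map_zero, map_zero]
  | add x y hx hy => rw [map_add, map_add, hx, hy]
  | tmul v v' => rfl

theorem tensorAut_mul (a c : V ≃ₗ[E] V) (b d : V' ≃ₗ[E] V') :
    tensorAut F (a * c) (b * d) = tensorAut F a b * tensorAut F c d := by
  apply LinearEquiv.ext
  intro x
  induction x using TensorProduct.induction_on with
  | zero => rw [map_zero, map_zero]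
  | add x y hx hy => rw [map_add, map_add, hx, hy]
  | tmul v v' => rfl

variable (h : V →ₛₗ[(τ : E →+* E)] V →ₗ[E] E) (h' : V' →ₗ[E] V' →ₛₗ[(τ : E →+* E)] E)
  (hτ : ∀ x, τ (τ x) = x)

theorem tensorAut_isometry (a : UnitaryGroup E (fun v w => h v w))
    (b : UnitaryGroup E (fun v w => h' v w)) :
    tensorAut F (a : V ≃ₗ[E] V) (b : V' ≃ₗ[E] V') ∈ Sp (dualPairForm (F := F) h h' hτ) := by
  intro x y
  induction x using TensorProduct.induction_on with
  | zero => simp only [map_zero, LinearMap.zero_apply]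
  | add x₁ x₂ h₁ h₂ => simp only [map_add, LinearMap.add_apply, h₁, h₂]
  | tmul v v' =>
    induction y using TensorProduct.induction_on with
    | zero => simp only [map_zero]
    | add y₁ y₂ h₁ h₂ => simp only [map_add, h₁, h₂]
    | tmul w w' =>
      have ha := a.2 v w
      have hb := b.2 v' w'
      simp only [tensorAut_tmul, dualPairForm_tmul, ha, hb]

/-- The natural map `U(V) × U(V') → Sp(V ⊗ V')`, `(g, g') ↦ g ⊗ g'`. -/
def dualPairHom : UnitaryGroup E (fun v w => h v w) × UnitaryGroup E (fun v w => h' v w) →*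
    Sp (dualPairForm (F := F) h h' hτ) where
  toFun g := ⟨tensorAut F (g.1 : V ≃ₗ[E] V) (g.2 : V' ≃ₗ[E] V'),
    tensorAut_isometry h h' hτ g.1 g.2⟩
  map_one' := Subtype.ext tensorAut_one
  map_mul' _ _ := Subtype.ext (tensorAut_mul _ _ _ _)

/-- The embedding `U(V) → Sp(V ⊗ V')`, `g ↦ g ⊗ id`. -/
def embLeft : UnitaryGroup E (fun v w => h v w) →* Sp (dualPairForm (F := F) h h' hτ) :=
  (dualPairHom h h' hτ).comp (MonoidHom.inl _ _)

/-- The embedding `U(V') → Sp(V ⊗ V')`, `g ↦ id ⊗ g`. -/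
def embRight : UnitaryGroup E (fun v w => h' v w) →* Sp (dualPairForm (F := F) h h' hτ) :=
  (dualPairHom h h' hτ).comp (MonoidHom.inr _ _)

end Embeddings

end DualPair

end

end LocalTheta

open LocalTheta

/-!
The operators of the two models differ by scalars. Conjugation by `Ψ` turns `M^Y_g` into an
operator over the same `g ∈ Sp(W)` as `M^B_g`, so the quotient of the two commutes with the
Heisenberg group, and Schur's lemma applies. Admissibility of the model is not needed for this;
Schur's lemma is used in Jacquet's form: the Heisenberg group of a `p`-adic space is separable, so
an irreducible smooth representation of it has countable dimension
(`rank_le_aleph0_of_smooth`), and over the uncountable field `ℂ` every operator on a nonzero space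
of countable dimension has spectrum (`spectrum_nonempty_of_rank_le_aleph0`). This gives `α`.

Conjugation by `Ψ` is also a topological isomorphism `coverEquiv` between the covers of a group in
the two models, compatible with the Weil representations. Pulling back along it transports
admissibility, big theta lifts and their unique irreducible quotients
(`thetaCorrespond_coverPullback`). It takes the point of the first cover over `g` with parameter
`z` to the point of the second one with parameter `z ξ(g)`, where `ξ = α β^Y (β^B)⁻¹`
(`coverEquiv_coverElt`). Hence `ξ` is multiplicative, and if `σ` extends `π`, then the pullback of
`σ` extends `π ⊗ ξ`.

Continuity of `ξ` comes from admissibility of the splitting in the first model: the pullback of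
`σ` to the first cover is admissible, so `π ⊗ ξ`, its pullback along the splitting, is smooth.
As `π` is smooth and nonzero, `ξ` is locally constant (`continuous_of_isSmooth_twist`).
-/

namespace LocalTheta

noncomputable section

/-! ### Schur's lemma in countable dimension -/

section Schur

open Polynomial in
/-- Resolvents of an operator without spectrum are linearly independent, by partial fractions. -/
theorem linearIndependent_resolvent {k S : Type*} [Field k] [IsAlgClosed k] [AddCommGroup S]
    [Module k S] {T : Module.End k S} (hT : spectrum k T = ∅) {v : S} (hv : v ≠ 0) :
    LinearIndependent k fun z : k => resolvent T z v := by
  classical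
  have hres : ∀ z : k, (algebraMap k (Module.End k S) z - T) * resolvent T z = 1 := fun z => by
    have hz : z ∉ spectrum k T := by simp [hT]
    exact Ring.mul_inverse_cancel _ (spectrum.notMem_iff.mp hz)
  rw [linearIndependent_iff']
  intro s c hc
  -- the numerator of `∑ c z / (z - X)` over the common denominator `∏ (w - X)`
  let P : k[X] := ∑ z ∈ s, C (c z) * ∏ w ∈ s.erase z, (C w - X)
  have hPv : aeval T P v = 0 := by
    have h1 : aeval T (∏ w ∈ s, (C w - X)) (∑ z ∈ s, c z • resolvent T z v) = 0 := by
      rw [hc, map_zero]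
    rw [← h1, map_sum, map_sum, LinearMap.sum_apply]
    refine Finset.sum_congr rfl fun z hz => ?_
    rw [← Finset.prod_erase_mul s _ hz, map_smul, map_mul, map_mul, aeval_C, map_sub, aeval_C,
      aeval_X, Module.End.mul_apply _ _ (resolvent T z v), ← Module.End.mul_apply _ _ v, hres,
      ← Algebra.smul_def]
    rfl
  -- a nonzero polynomial in an operator without spectrum is invertible, so `P(T) v = 0` forces
  -- `P = 0`
  have hP : P = 0 := by
    by_contra hP
    have hu : IsUnit (aeval T P) := by
      by_contra hu
      have h3 := spectrum.zero_mem_iff k |>.mpr hu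
      by_cases hd : 0 < P.degree
      · rw [spectrum.map_polynomial_aeval_of_degree_pos T P hd, hT] at h3
        simp at h3
      · rw [eq_C_of_degree_le_zero (not_lt.mp hd)] at hu hP
        rw [aeval_C] at hu
        exact hu ((isUnit_iff_ne_zero.mpr fun h0 => hP (by rw [h0, C_0])).map _)
    have hinj := ((Module.End.isUnit_iff _).mp hu).1
    exact hv (hinj (hPv.trans (map_zero _).symm))
  intro z hz
  have h4 : P.eval z = c z * ∏ w ∈ s.erase z, (w - z) := by
    rw [eval_finsetSum, Finset.sum_eq_single_of_mem z hz]
    · simp [eval_prod]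
    · intro w _ hwz
      rw [eval_mul, eval_prod, Finset.prod_eq_zero (Finset.mem_erase.mpr ⟨hwz.symm, hz⟩) (by simp),
        mul_zero]
  rw [hP, eval_zero, eq_comm, mul_eq_zero] at h4
  refine h4.resolve_right (Finset.prod_ne_zero_iff.mpr fun w hw => ?_)
  exact sub_ne_zero.mpr (Finset.ne_of_mem_erase hw)

/-- An operator on a nonzero complex vector space of countable dimension has spectrum: otherwise
its resolvents would give uncountably many independent vectors. -/
theorem spectrum_nonempty_of_rank_le_aleph0 {S : Type*} [AddCommGroup S] [Module ℂ S]
    [Nontrivial S] (hS : Module.rank ℂ S ≤ Cardinal.aleph0) (T : Module.End ℂ S) :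
    (spectrum ℂ T).Nonempty := by
  by_contra hT
  obtain ⟨v, hv⟩ := exists_ne (0 : S)
  have hli := (linearIndependent_resolvent (Set.not_nonempty_iff_eq_empty.mp hT)
    hv).cardinal_lift_le_rank
  have h := hli.trans (Cardinal.lift_le.mpr hS)
  rw [Cardinal.mk_complex, Cardinal.lift_continuum, Cardinal.lift_aleph0] at h
  exact (not_le.mpr Cardinal.aleph0_lt_continuum) h

variable {G : Type*} [Group G] {S : Type*} [AddCommGroup S] [Module ℂ S]

theorem nontrivial_of_isIrreducible {ρ : Representation ℂ G S} (hρ : ρ.IsIrreducible) :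
    Nontrivial S := by
  by_contra hn
  have := not_nontrivial_iff_subsingleton.mp hn
  exact bot_ne_top (α := Subrepresentation ρ)
    (Subrepresentation.toSubmodule_injective (Subsingleton.elim _ _))

/-- Schur's lemma in countable dimension. -/
theorem exists_eq_smul_of_commute {ρ : Representation ℂ G S} (hρ : ρ.IsIrreducible)
    (hS : Module.rank ℂ S ≤ Cardinal.aleph0) (T : Module.End ℂ S)
    (hT : ∀ g v, T (ρ g v) = ρ g (T v)) : ∃ z : ℂ, ∀ v, T v = z • v := by
  have := nontrivial_of_isIrreducible hρ
  obtain ⟨z, hz⟩ := spectrum_nonempty_of_rank_le_aleph0 hS T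
  refine ⟨z, fun v => ?_⟩
  let f : Representation.IntertwiningMap ρ ρ :=
    ⟨algebraMap ℂ (Module.End ℂ S) z - T, fun g => by
      ext v
      simp [Module.algebraMap_end_apply, hT]⟩
  rcases Representation.IsIrreducible.bijective_or_eq_zero f with hf | hf
  · exact absurd ((Module.End.isUnit_iff _).mpr hf) hz
  · have h1 : f v = 0 := by rw [hf]; rfl
    exact (sub_eq_zero.mp h1).symm

/-- Orbits of a smooth representation of a separable group are countable, as stabilizers are
open. -/
theorem countable_orbit [TopologicalSpace G] [ContinuousConstSMul G G]
    [TopologicalSpace.SeparableSpace G] {ρ : Representation ℂ G S} (hρ : IsSmooth ρ) (v : S) :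
    (Set.range fun g => ρ g v).Countable := by
  obtain ⟨D, hDc, hD⟩ := TopologicalSpace.exists_countable_dense G
  refine (hDc.image fun g => ρ g v).mono ?_
  rintro _ ⟨g, rfl⟩
  have ho : IsOpen {x : G | ρ (g⁻¹ • x) v = v} := (hρ v).preimage (continuous_const_smul g⁻¹)
  obtain ⟨x, hx, hxD⟩ := hD.inter_open_nonempty _ ho ⟨g, by simp⟩
  refine ⟨x, hxD, ?_⟩
  have h1 := congrArg (ρ g) (show ρ (g⁻¹ * x) v = v from hx)
  rwa [← Module.End.mul_apply, ← map_mul, mul_inv_cancel_left] at h1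

/-- The space of an irreducible representation is spanned by the orbit of any nonzero vector. -/
theorem rank_le_aleph0_of_smooth [TopologicalSpace G] [ContinuousConstSMul G G]
    [TopologicalSpace.SeparableSpace G] {ρ : Representation ℂ G S} (hirr : ρ.IsIrreducible)
    (hρ : IsSmooth ρ) : Module.rank ℂ S ≤ Cardinal.aleph0 := by
  cases subsingleton_or_nontrivial S
  · simp
  obtain ⟨v, hv⟩ := exists_ne (0 : S)
  let N : Subrepresentation ρ := ⟨Submodule.span ℂ (Set.range fun g => ρ g v), fun g w hw => by
    have hle : Submodule.span ℂ (Set.range fun g => ρ g v) ≤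
        (Submodule.span ℂ (Set.range fun g => ρ g v)).comap (ρ g) := by
      rw [Submodule.span_le]
      rintro _ ⟨x, rfl⟩
      exact Submodule.subset_span ⟨g * x, by simp⟩
    exact hle hw⟩
  have hvN : v ∈ N.toSubmodule := Submodule.subset_span ⟨1, by simp⟩
  have hN : N.toSubmodule = ⊤ := by
    rcases eq_bot_or_eq_top N with h | h
    · rw [h] at hvN
      exact absurd ((Submodule.mem_bot ℂ).mp hvN) hv
    · rw [h]; rfl
  rw [← rank_top ℂ S, ← hN]
  exact (rank_span_le _).trans (Cardinal.le_aleph0_iff_set_countable.mpr (countable_orbit hρ v))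

end Schur

/-! ### Topology of the Heisenberg group and of isometry groups -/

section Topology

theorem separableSpace_of_isModuleTopology (R M : Type*) [Ring R] [TopologicalSpace R]
    [IsTopologicalRing R] [TopologicalSpace.SeparableSpace R] [AddCommGroup M] [Module R M]
    [Module.Finite R M] [TopologicalSpace M] [IsModuleTopology R M] :
    TopologicalSpace.SeparableSpace M := by
  obtain ⟨n, f, hf⟩ := Module.Finite.exists_fin' R M
  have := IsModuleTopology.toContinuousAdd R M
  exact hf.denseRange.separableSpace (IsModuleTopology.continuous_of_linearMap f)

instance isometryGroup.continuousConstSMul {K M N : Type*} [CommRing K] [AddCommGroup M]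
    [Module K M] [TopologicalSpace K] (B : M → M → N) :
    ContinuousConstSMul (isometryGroup K B) (isometryGroup K B) where
  continuous_const_smul a := by
    let _ : TopologicalSpace (M →ₗ[K] M) := moduleTopology K (M →ₗ[K] M)
    have : IsModuleTopology K (M →ₗ[K] M) := ⟨rfl⟩
    have : ContinuousAdd (M →ₗ[K] M) := IsModuleTopology.toContinuousAdd K _
    have hc : Continuous (LinearMap.llcomp K M M M ((a : M ≃ₗ[K] M) : M →ₗ[K] M)) :=
      IsModuleTopology.continuous_of_linearMap (A := M →ₗ[K] M) (B := M →ₗ[K] M) _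
    exact continuous_induced_rng.mpr (hc.comp continuous_induced_dom)

variable {F W : Type*} [Field F] [AddCommGroup W] [Module F W] [TopologicalSpace F]
  (B : LinearMap.BilinForm F W)

/-- Only left translations are needed, and each is continuous because `B a` is linear. -/
instance Heisenberg.continuousConstSMul [IsTopologicalRing F] :
    ContinuousConstSMul (Heisenberg B) (Heisenberg B) where
  continuous_const_smul a := by
    let _ : TopologicalSpace W := moduleTopology F W
    have : IsModuleTopology F W := ⟨rfl⟩
    have : ContinuousAdd W := IsModuleTopology.toContinuousAdd F _
    have hc : Continuous (B a.vec) := IsModuleTopology.continuous_of_linearMap _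
    have hi : Continuous fun x : Heisenberg B => (x.vec, x.scal) := continuous_induced_dom
    have h2 : Continuous fun x : Heisenberg B =>
        (a.vec + x.vec, a.scal + x.scal + (2 : F)⁻¹ * B a.vec x.vec) :=
      (continuous_const.add hi.fst).prodMk
        ((continuous_const.add hi.snd).add (continuous_const.mul (hc.comp hi.fst)))
    exact continuous_induced_rng.mpr h2

theorem Heisenberg.separableSpace [IsTopologicalRing F] [TopologicalSpace.SeparableSpace F]
    [FiniteDimensional F W] : TopologicalSpace.SeparableSpace (Heisenberg B) := by
  let _ : TopologicalSpace W := moduleTopology F W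
  have : IsModuleTopology F W := ⟨rfl⟩
  have := separableSpace_of_isModuleTopology F W
  have hc : Continuous fun x : W × F => (⟨x.1, x.2⟩ : Heisenberg B) :=
    continuous_induced_rng.mpr continuous_id
  have hs : Function.Surjective fun x : W × F => (⟨x.1, x.2⟩ : Heisenberg B) :=
    fun a => ⟨(a.vec, a.scal), rfl⟩
  exact hs.denseRange.separableSpace hc

end Topology

/-! ### Change of group and twists -/

section Transfer

variable {G G₁ G₂ : Type*} [Group G] [Group G₁] [Group G₂]
variable {U : Type*} [AddCommGroup U] [Module ℂ U]

/-- Two representations on the same space with the same stable subspaces have isomorphic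
lattices of subrepresentations. -/
def subrepresentationCongr {π₁ : Representation ℂ G₁ U} {π₂ : Representation ℂ G₂ U}
    (h : ∀ N : Submodule ℂ U, (∀ g, ∀ ⦃v⦄, v ∈ N → π₁ g v ∈ N) ↔ ∀ g, ∀ ⦃v⦄, v ∈ N → π₂ g v ∈ N) :
    Subrepresentation π₁ ≃o Subrepresentation π₂ where
  toFun N := ⟨N.toSubmodule, (h _).mp N.apply_mem_toSubmodule⟩
  invFun N := ⟨N.toSubmodule, (h _).mpr N.apply_mem_toSubmodule⟩
  left_inv _ := rfl
  right_inv _ := rfl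
  map_rel_iff' := Iff.rfl

theorem stable_comp_iff (e : G₁ ≃* G₂) (π : Representation ℂ G₂ U) (N : Submodule ℂ U) :
    (∀ g, ∀ ⦃v⦄, v ∈ N → MonoidHom.comp π (e : G₁ →* G₂) g v ∈ N) ↔
      ∀ g, ∀ ⦃v⦄, v ∈ N → π g v ∈ N :=
  ⟨fun h g v hv => by simpa using h (e.symm g) hv, fun h g _ hv => h (e g) hv⟩

theorem isIrreducible_comp (e : G₁ ≃* G₂) {π : Representation ℂ G₂ U} (hπ : π.IsIrreducible) :
    Representation.IsIrreducible (MonoidHom.comp π (e : G₁ →* G₂)) :=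
  (OrderIso.isSimpleOrder_iff (subrepresentationCongr (stable_comp_iff e π))).mpr hπ

theorem isIrreducible_twist {π : Representation ℂ G U} (hπ : π.IsIrreducible) (ξ : G →* ℂˣ) :
    (twist π ξ).IsIrreducible :=
  (OrderIso.isSimpleOrder_iff (subrepresentationCongr fun N =>
    forall_congr' fun g => forall_congr' fun _ => imp_congr_right fun _ =>
      N.smul_mem_iff (ξ g).ne_zero)).mpr hπ

variable [TopologicalSpace G₁] [TopologicalSpace G₂]

theorem isAdmissible_comp (e : G₁ ≃ₜ* G₂) {π : Representation ℂ G₂ U} (hπ : IsAdmissible π) :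
    IsAdmissible (MonoidHom.comp π (e.toMulEquiv : G₁ →* G₂)) where
  smooth v := (hπ.smooth v).preimage e.continuous_toFun
  finite K ho hc := by
    have himg : ((K.map (e.toMulEquiv : G₁ →* G₂) : Subgroup G₂) : Set G₂) =
        e.toHomeomorph '' (K : Set G₁) := rfl
    have hfin := hπ.finite (K.map (e.toMulEquiv : G₁ →* G₂))
      (himg ▸ e.toHomeomorph.isOpenMap _ ho) (himg ▸ hc.image e.toHomeomorph.continuous)
    convert! hfin using 2
    all_goals
      ext v
      constructor
      · rintro h ⟨_, g, hg, rfl⟩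
        exact h ⟨g, hg⟩
      · rintro h ⟨g, hg⟩
        exact h ⟨_, g, hg, rfl⟩

/-- If `π ≠ 0` and `π ⊗ ξ` are smooth, then `ξ` is trivial on the intersection of the two open
stabilizers of a nonzero vector, hence continuous. -/
theorem continuous_of_isSmooth_twist [TopologicalSpace G] [ContinuousConstSMul G G] [Nontrivial U]
    {π : Representation ℂ G U} (hπ : IsSmooth π) {ξ : G →* ℂˣ} (hξ : IsSmooth (twist π ξ)) :
    Continuous ξ := by
  obtain ⟨v, hv⟩ := exists_ne (0 : U)
  rw [continuous_iff_continuousAt]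
  intro g
  have ho : IsOpen {x : G | π (g⁻¹ • x) v = v ∧ twist π ξ (g⁻¹ • x) v = v} :=
    ((hπ v).inter (hξ v)).preimage (continuous_const_smul g⁻¹)
  -- `ξ` is constant on this neighbourhood of `g`
  have hg : g ∈ {x : G | π (g⁻¹ • x) v = v ∧ twist π ξ (g⁻¹ • x) v = v} := by
    simp
  have heq : ξ =ᶠ[nhds g] fun _ => ξ g := by
    filter_upwards [ho.mem_nhds hg] with x hx
    have h1 : (ξ (g⁻¹ * x) : ℂ) • π (g⁻¹ * x) v = v := hx.2
    have h2 : π (g⁻¹ * x) v = v := hx.1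
    rw [h2] at h1
    have h3 : ((ξ (g⁻¹ * x) : ℂ) - 1) • v = 0 := by rw [sub_smul, h1, one_smul, sub_self]
    have h4 : ξ (g⁻¹ * x) = 1 :=
      Units.ext (sub_eq_zero.mp ((smul_eq_zero.mp h3).resolve_right hv))
    rw [map_mul, map_inv, inv_mul_eq_one] at h4
    exact h4.symm
  exact continuousAt_const.congr heq.symm

end Transfer

/-! ### Transport of structure between two models -/

section Cover

variable {F W : Type*} [Field F] [AddCommGroup W] [Module F W] {B : LinearMap.BilinForm F W}
variable {S : Type*} [AddCommGroup S] [Module ℂ S] {ρ : Representation ℂ (Heisenberg B) S}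
variable {S₂ : Type*} [AddCommGroup S₂] [Module ℂ S₂] {ρ₂ : Representation ℂ (Heisenberg B) S₂}
variable {G : Type*} [Group G]

theorem equiv_apply {V₁ V₂ : Type*} [AddCommGroup V₁] [Module ℂ V₁] [AddCommGroup V₂]
    [Module ℂ V₂] {ρ₁ : Representation ℂ G V₁} {ρ₂ : Representation ℂ G V₂}
    (Ψ : Representation.Equiv ρ₁ ρ₂) (a : G) (φ : V₁) : Ψ (ρ₁ a φ) = ρ₂ a (Ψ φ) :=
  Ψ.toIntertwiningMap.isIntertwining _ _ a φ

/-- The map `(g, M) ↦ (g, Ψ M Ψ⁻¹)` of metaplectic covers induced by an isomorphism `Ψ` of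
representations of the Heisenberg group. -/
def Mp.map (Ψ : Representation.Equiv ρ ρ₂) : Mp ρ →* Mp ρ₂ where
  toFun x := ⟨(x.1.1, Ψ.toLinearEquiv.symm.trans (x.1.2.trans Ψ.toLinearEquiv)), fun a φ => by
    change Ψ (x.1.2 (Ψ.symm (ρ₂ a φ))) =
      ρ₂ ⟨(x.1.1 : W ≃ₗ[F] W) a.vec, a.scal⟩ (Ψ (x.1.2 (Ψ.symm φ)))
    rw [← equiv_apply, equiv_apply Ψ.symm, x.2]⟩
  map_one' := by
    apply Subtype.ext
    apply Prod.ext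
    · rfl
    · exact LinearEquiv.ext fun φ => Ψ.apply_symm_apply φ
  map_mul' x y := by
    apply Subtype.ext
    apply Prod.ext
    · rfl
    · refine LinearEquiv.ext fun φ => ?_
      change Ψ (x.1.2 (y.1.2 (Ψ.symm φ))) = Ψ (x.1.2 (Ψ.symm (Ψ (y.1.2 (Ψ.symm φ)))))
      rw [Ψ.symm_apply_apply]

theorem Mp.map_symm_map (Ψ : Representation.Equiv ρ ρ₂) (x : Mp ρ) :
    Mp.map Ψ.symm (Mp.map Ψ x) = x := by
  apply Subtype.ext
  apply Prod.ext
  · rfl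
  · refine LinearEquiv.ext fun φ => ?_
    change Ψ.symm (Ψ (x.1.2 (Ψ.symm (Ψ φ)))) = x.1.2 φ
    rw [Ψ.symm_apply_apply, Ψ.symm_apply_apply]

theorem Mp.continuous_map [TopologicalSpace F] (Ψ : Representation.Equiv ρ ρ₂) :
    Continuous (Mp.map Ψ) := by
  refine continuous_inf_rng.mpr ⟨continuous_induced_rng.mpr ?_, continuous_iInf_rng.mpr fun φ =>
    continuous_induced_rng.mpr ?_⟩
  · exact continuous_iff_le_induced.mpr inf_le_left
  · let _ : TopologicalSpace S := ⊥
    let _ : TopologicalSpace S₂ := ⊥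
    have : DiscreteTopology S := ⟨rfl⟩
    have h1 : Continuous fun x : Mp ρ => x.1.2 (Ψ.symm φ) :=
      continuous_iff_le_induced.mpr (inf_le_right.trans (iInf_le _ (Ψ.symm φ)))
    exact (continuous_of_discreteTopology (f := Ψ)).comp h1

/-- The isomorphism of the covers of `G` in two isomorphic models. -/
def coverEquiv [TopologicalSpace F] (Ψ : Representation.Equiv ρ ρ₂) (ι : G →* Sp B) :
    cover ρ ι ≃ₜ* cover ρ₂ ι where
  toFun x := ⟨Mp.map Ψ x.1, x.2⟩
  invFun x := ⟨Mp.map Ψ.symm x.1, x.2⟩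
  left_inv x := Subtype.ext (Mp.map_symm_map Ψ x.1)
  right_inv x := Subtype.ext (Mp.map_symm_map Ψ.symm x.1)
  map_mul' x y := Subtype.ext (map_mul (Mp.map Ψ) x.1 y.1)
  continuous_toFun := ((Mp.continuous_map Ψ).comp continuous_subtype_val).subtype_mk _
  continuous_invFun := ((Mp.continuous_map Ψ.symm).comp continuous_subtype_val).subtype_mk _

/-- The pullback to the first model of a representation of the cover in the second model. -/
abbrev coverPullback [TopologicalSpace F] (Ψ : Representation.Equiv ρ ρ₂) (ι : G →* Sp B)
    {U : Type*} [AddCommGroup U] [Module ℂ U] (σ : Representation ℂ (cover ρ₂ ι) U) :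
    Representation ℂ (cover ρ ι) U :=
  MonoidHom.comp σ ((coverEquiv Ψ ι).toMulEquiv : cover ρ ι →* cover ρ₂ ι)

theorem mem_isotypicKernel {H : Subgroup (Mp ρ)} {U : Type*} [AddCommGroup U]
    [Module ℂ U] {π : Representation ℂ H U} {φ : S} :
    φ ∈ isotypicKernel π ↔
      ∀ f : S →ₗ[ℂ] U, (∀ (x : H) (φ : S), f (weil ρ x φ) = π x (f φ)) → f φ = 0 := by
  rw [isotypicKernel, Submodule.mem_iInf]
  exact ⟨fun h f hf => h ⟨f, hf⟩, fun h f => h f.1 f.2⟩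

variable [TopologicalSpace F] (Ψ : Representation.Equiv ρ ρ₂) (ι : G →* Sp B)
variable {U : Type*} [AddCommGroup U] [Module ℂ U]

theorem weil_coverEquiv (x : cover ρ ι) (φ : S) :
    weil ρ₂ (coverEquiv Ψ ι x) (Ψ φ) = Ψ (weil ρ x φ) := by
  change Ψ (x.1.1.2 (Ψ.symm (Ψ φ))) = _
  rw [Ψ.symm_apply_apply]
  rfl

theorem isIrreducibleAdmissible_coverPullback {σ : Representation ℂ (cover ρ₂ ι) U}
    (hσ : IsIrreducibleAdmissible σ) : IsIrreducibleAdmissible (coverPullback Ψ ι σ) :=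
  ⟨isIrreducible_comp _ hσ.irreducible, isAdmissible_comp _ hσ.admissible⟩

theorem isotypicKernel_coverPullback (σ : Representation ℂ (cover ρ₂ ι) U) :
    isotypicKernel (coverPullback Ψ ι σ) =
      (isotypicKernel σ).comap (Ψ.toLinearEquiv : S →ₗ[ℂ] S₂) := by
  ext φ
  rw [Submodule.mem_comap, mem_isotypicKernel, mem_isotypicKernel]
  constructor
  · intro h f hf
    refine h (f ∘ₗ (Ψ.toLinearEquiv : S →ₗ[ℂ] S₂)) fun (x : cover ρ ι) φ => ?_
    change f (Ψ (weil ρ x φ)) = σ (coverEquiv Ψ ι x) (f (Ψ φ))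
    rw [← weil_coverEquiv, hf]
  · intro h f hf
    have h1 := h (f ∘ₗ (Ψ.toLinearEquiv.symm : S₂ →ₗ[ℂ] S)) fun (y : cover ρ₂ ι) φ => by
      obtain ⟨x, rfl⟩ := (coverEquiv Ψ ι).surjective y
      obtain ⟨φ, rfl⟩ := Ψ.toLinearEquiv.surjective φ
      change f (Ψ.symm (weil ρ₂ (coverEquiv Ψ ι x) (Ψ φ))) =
        coverPullback Ψ ι σ x (f (Ψ.symm (Ψ φ)))
      rw [weil_coverEquiv, Ψ.symm_apply_apply, Ψ.symm_apply_apply, hf]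
    change f (Ψ.symm (Ψ φ)) = 0 at h1
    rwa [Ψ.symm_apply_apply] at h1

variable {G' : Type*} [Group G'] (ι' : G' →* Sp B)

theorem isBigTheta_coverPullback {T : Type*} [AddCommGroup T] [Module ℂ T]
    {σ : Representation ℂ (cover ρ₂ ι) U} {Θ : Representation ℂ (cover ρ₂ ι') T}
    (h : IsBigTheta σ Θ) : IsBigTheta (coverPullback Ψ ι σ) (coverPullback Ψ ι' Θ) := by
  obtain ⟨q, hq, hker, h1, h2⟩ := h
  refine ⟨q ∘ₗ (Ψ.toLinearEquiv : S →ₗ[ℂ] S₂), hq.comp Ψ.toLinearEquiv.surjective, ?_, ?_, ?_⟩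
  · rw [LinearMap.ker_comp, hker, isotypicKernel_coverPullback]
  · intro x φ
    change q (Ψ (weil ρ x φ)) = _
    rw [← weil_coverEquiv, h1]
    rfl
  · intro x φ
    change q (Ψ (weil ρ x φ)) = _
    rw [← weil_coverEquiv, h2]
    rfl

theorem isUniqueIrreducibleQuotient_coverPullback {T : Type*} [AddCommGroup T] [Module ℂ T]
    {Θ : Representation ℂ (cover ρ₂ ι) T} {σ : Representation ℂ (cover ρ₂ ι) U}
    (h : IsUniqueIrreducibleQuotient Θ σ) :
    IsUniqueIrreducibleQuotient (coverPullback Ψ ι Θ) (coverPullback Ψ ι σ) := by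
  obtain ⟨hirr, r, hr, hN⟩ := h
  refine ⟨isIrreducible_comp _ hirr, ⟨r.toLinearMap, fun x => r.isIntertwining' _⟩, hr,
    fun N hc => ?_⟩
  let e := subrepresentationCongr (stable_comp_iff (coverEquiv Ψ ι).toMulEquiv Θ)
  have h1 := congrArg Subrepresentation.toSubmodule (hN (e N) ((e.isCoatom_iff N).mpr hc))
  exact Subrepresentation.toSubmodule_injective h1

theorem thetaCorrespond_coverPullback {U U' : Type u} [AddCommGroup U] [Module ℂ U]
    [AddCommGroup U'] [Module ℂ U'] {σ : Representation ℂ (cover ρ₂ ι) U}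
    {σ' : Representation ℂ (cover ρ₂ ι') U'} (h : ThetaCorrespond σ σ') :
    ThetaCorrespond (coverPullback Ψ ι σ) (coverPullback Ψ ι' σ') := by
  obtain ⟨hσ, hσ', T, _, _, Θ, hΘ, hq⟩ := h
  exact ⟨isIrreducibleAdmissible_coverPullback Ψ ι hσ,
    isIrreducibleAdmissible_coverPullback Ψ ι' hσ', T, _, _, coverPullback Ψ ι' Θ,
    isBigTheta_coverPullback Ψ ι ι' hΘ, isUniqueIrreducibleQuotient_coverPullback Ψ ι' hq⟩

end Cover

/-! ### Comparison of operators and of splittings -/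

section Splittings

variable {F W : Type*} [Field F] [AddCommGroup W] [Module F W] {B : LinearMap.BilinForm F W}
variable {S : Type*} [AddCommGroup S] [Module ℂ S] {ρ : Representation ℂ (Heisenberg B) S}
variable {S₂ : Type*} [AddCommGroup S₂] [Module ℂ S₂] {ρ₂ : Representation ℂ (Heisenberg B) S₂}
variable {G : Type*} [Group G]

/-- Two elements of `Mp(W)` over the same `g ∈ Sp(W)` differ by a scalar. -/
theorem exists_scalarAut_mul_eq (hirr : ρ.IsIrreducible)
    (hS : Module.rank ℂ S ≤ Cardinal.aleph0) {g : Sp B} {M N : S ≃ₗ[ℂ] S}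
    (hM : (g, M) ∈ Mp ρ) (hN : (g, N) ∈ Mp ρ) : ∃ z : ℂˣ, scalarAut S z * N = M := by
  obtain ⟨z, hz⟩ := exists_eq_smul_of_commute hirr hS ((M * N⁻¹ : S ≃ₗ[ℂ] S) : S →ₗ[ℂ] S)
    fun a φ => by
      obtain ⟨φ, rfl⟩ := N.surjective φ
      have hMN := (Mp ρ).mul_mem hM ((Mp ρ).inv_mem hN) a (N φ)
      simpa using hMN
  have hn := nontrivial_of_isIrreducible hirr
  obtain ⟨v, hv⟩ := exists_ne (0 : S)
  have hz0 : z ≠ 0 := by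
    rintro rfl
    have h1 := hz v
    rw [zero_smul] at h1
    exact hv ((M * N⁻¹).injective (h1.trans (map_zero _).symm))
  refine ⟨Units.mk0 z hz0, ?_⟩
  rw [← eq_mul_inv_iff_mul_eq]
  exact (LinearEquiv.ext hz).symm

/-- Uses the operators `Ψ M^Y Ψ⁻¹` and `M^B` of the second model, which lie over the same
elements of `Sp(W)`. -/
theorem exists_isComparison (hirr : ρ₂.IsIrreducible) (hS : Module.rank ℂ S₂ ≤ Cardinal.aleph0)
    (MY : OperatorChoice ρ) (MB : OperatorChoice ρ₂) (Ψ : Representation.Equiv ρ ρ₂)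
    (ι : G →* Sp B) : ∃ α : G → ℂˣ, IsComparison MY MB Ψ ι α := by
  choose α hα using fun g : G => exists_scalarAut_mul_eq hirr hS
    (Mp.map Ψ ⟨(ι g, MY.op (ι g)), MY.mem (ι g)⟩).2 (MB.mem (ι g))
  refine ⟨α, fun g φ => ?_⟩
  have h1 := DFunLike.congr_fun (hα g) (Ψ φ)
  change (α g : ℂ) • MB.op (ι g) (Ψ φ) = Ψ (MY.op (ι g) (Ψ.symm (Ψ φ))) at h1
  rwa [Ψ.symm_apply_apply] at h1

theorem coverElt_injective [Nontrivial S] (M : OperatorChoice ρ) (ι : G →* Sp B) (β : G → ℂˣ)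
    (g : G) : Function.Injective (coverElt M ι β g) := by
  intro z w hzw
  obtain ⟨v, hv⟩ := exists_ne (0 : S)
  obtain ⟨v, rfl⟩ := (M.op (ι g)).surjective v
  have h1 : ((z * β g : ℂˣ) : ℂ) • M.op (ι g) v = ((w * β g : ℂˣ) : ℂ) • M.op (ι g) v :=
    congrArg (fun x : cover ρ ι => x.1.1.2 v) hzw
  exact mul_right_cancel (Units.ext (smul_left_injective ℂ hv h1))

variable {MY : OperatorChoice ρ} {MB : OperatorChoice ρ₂} {Ψ : Representation.Equiv ρ ρ₂}
  {ι : G →* Sp B} {α βY βB : G → ℂˣ}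

theorem coverElt_mul (hβ : IsSplitting MY ι βY) (g g' : G) (z z' : ℂˣ) :
    coverElt MY ι βY g z * coverElt MY ι βY g' z' = coverElt MY ι βY (g * g') (z * z') := by
  have h1 := (map_mul (liftHom hβ) g g').symm
  apply Subtype.ext
  apply Subtype.ext
  apply Prod.ext
  · exact (map_mul ι g g').symm
  · refine LinearEquiv.ext fun φ => ?_
    have h2 : ((1 * βY g : ℂˣ) : ℂ) • MY.op (ι g) (((1 * βY g' : ℂˣ) : ℂ) • MY.op (ι g') φ) =
        ((1 * βY (g * g') : ℂˣ) : ℂ) • MY.op (ι (g * g')) φ :=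
      congrArg (fun x : cover ρ ι => x.1.1.2 φ) h1
    change ((z * βY g : ℂˣ) : ℂ) • MY.op (ι g) (((z' * βY g' : ℂˣ) : ℂ) • MY.op (ι g') φ) =
        ((z * z' * βY (g * g') : ℂˣ) : ℂ) • MY.op (ι (g * g')) φ
    rw [map_smul, smul_smul] at h2 ⊢
    push_cast at h2 ⊢
    rw [one_mul, one_mul, one_mul] at h2
    rw [mul_mul_mul_comm, mul_smul, h2, ← mul_smul]

/-- An extension of a representation to the cover pulls back to it along the splitting. -/
theorem comp_liftHom_eq {U : Type*} [AddCommGroup U] [Module ℂ U]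
    {π : Representation ℂ G U} {σ : Representation ℂ (cover ρ ι) U}
    (hβ : IsSplitting MY ι βY) (hσ : IsExtension MY ι βY π σ) :
    MonoidHom.comp σ (liftHom hβ) = π := by
  ext1 g
  exact (hσ g 1).trans (by rw [Units.val_one, one_smul])

variable [TopologicalSpace F]

/-- In the coordinates `(g, z)` given by the operators and splittings, the isomorphism of covers
multiplies `z` by the ratio `α β^Y (β^B)⁻¹`. -/
theorem coverEquiv_coverElt (hα : IsComparison MY MB Ψ ι α) (g : G) (z : ℂˣ) :
    coverEquiv Ψ ι (coverElt MY ι βY g z) =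
      coverElt MB ι βB g (z * (α g * βY g * (βB g)⁻¹)) := by
  apply Subtype.ext
  apply Subtype.ext
  apply Prod.ext
  · rfl
  · refine LinearEquiv.ext fun φ => ?_
    obtain ⟨φ, rfl⟩ := Ψ.toLinearEquiv.surjective φ
    change Ψ (((z * βY g : ℂˣ) : ℂ) • MY.op (ι g) (Ψ.symm (Ψ φ))) =
      ((z * (α g * βY g * (βB g)⁻¹) * βB g : ℂˣ) : ℂ) • MB.op (ι g) (Ψ φ)
    rw [Ψ.symm_apply_apply, map_smul, ← hα, smul_smul, ← Units.val_mul]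
    congr 2
    rw [mul_assoc z (α g * βY g * (βB g)⁻¹), inv_mul_cancel_right, mul_assoc, mul_comm (βY g)]

/-- The ratio `ξ = α β^Y (β^B)⁻¹` of two splittings, as a homomorphism: the isomorphism of covers
takes one section of the cover to `ξ` times the other, and both sections are multiplicative. -/
def ratioHom [Nontrivial S₂] (hα : IsComparison MY MB Ψ ι α) (hβY : IsSplitting MY ι βY)
    (hβB : IsSplitting MB ι βB) : G →* ℂˣ :=
  MonoidHom.mk' (fun g => α g * βY g * (βB g)⁻¹) fun g g' => by
    apply coverElt_injective MB ι βB (g * g')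
    have h1 := congrArg (coverEquiv Ψ ι) (coverElt_mul hβY g g' 1 1)
    rw [map_mul, coverEquiv_coverElt (βB := βB) hα, coverEquiv_coverElt (βB := βB) hα,
      coverEquiv_coverElt (βB := βB) hα, coverElt_mul hβB] at h1
    simpa only [one_mul] using h1.symm

variable {U : Type*} [AddCommGroup U] [Module ℂ U] {π : Representation ℂ G U}
  {σ : Representation ℂ (cover ρ₂ ι) U}

theorem isExtension_coverPullback (hα : IsComparison MY MB Ψ ι α) (hσ : IsExtension MB ι βB π σ)
    {ξ : G →* ℂˣ} (hξ : ∀ g, ξ g = α g * βY g * (βB g)⁻¹) :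
    IsExtension MY ι βY (twist π ξ) (coverPullback Ψ ι σ) := by
  intro g z
  change σ (coverEquiv Ψ ι (coverElt MY ι βY g z)) = (z : ℂ) • ((ξ g : ℂ) • π g)
  rw [coverEquiv_coverElt (βB := βB) hα, hσ, ← hξ, Units.val_mul, mul_smul]

end Splittings

/-- For one member of the dual pair: `ξ = α β^Y (β^B)⁻¹` is a continuous character, and the
twist of `π` by it is irreducible admissible with extension `coverPullback Ψ ι σ`. -/
theorem exists_ratio_character {F W : Type*} [Field F] [AddCommGroup W] [Module F W]
    {B : LinearMap.BilinForm F W} [TopologicalSpace F]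
    {S : Type*} [AddCommGroup S] [Module ℂ S] {ρ : Representation ℂ (Heisenberg B) S}
    {S₂ : Type*} [AddCommGroup S₂] [Module ℂ S₂] {ρ₂ : Representation ℂ (Heisenberg B) S₂}
    (hirr : ρ₂.IsIrreducible) (hS : Module.rank ℂ S₂ ≤ Cardinal.aleph0)
    {G : Type*} [Group G] [TopologicalSpace G] [ContinuousConstSMul G G]
    {MY : OperatorChoice ρ} {MB : OperatorChoice ρ₂} (Ψ : Representation.Equiv ρ ρ₂)
    {ι : G →* Sp B} {βY βB : G → ℂˣ} (hβY : IsAdmissibleSplitting.{u} MY ι βY)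
    (hβB : IsSplitting MB ι βB) {U : Type u} [AddCommGroup U] [Module ℂ U]
    {π : Representation ℂ G U} (hπ : IsIrreducibleAdmissible π)
    {σ : Representation ℂ (cover ρ₂ ι) U} (hσ : IsExtension MB ι βB π σ)
    (hσadm : IsAdmissible σ) :
    ∃ (α : G → ℂˣ) (ξ : G →* ℂˣ), IsComparison MY MB Ψ ι α ∧
      (∀ g, ξ g = α g * βY g * (βB g)⁻¹) ∧ Continuous ξ ∧
      IsIrreducibleAdmissible (twist π ξ) ∧
      IsExtension MY ι βY (twist π ξ) (coverPullback Ψ ι σ) := by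
  have := nontrivial_of_isIrreducible hirr
  have := nontrivial_of_isIrreducible hπ.irreducible
  obtain ⟨α, hα⟩ := exists_isComparison hirr hS MY MB Ψ ι
  obtain ⟨hsplit, hpull⟩ := hβY
  let ξ := ratioHom hα hsplit hβB
  have hext : IsExtension MY ι βY (twist π ξ) (coverPullback Ψ ι σ) :=
    isExtension_coverPullback hα hσ fun _ => rfl
  have hadm : IsAdmissible (twist π ξ) :=
    comp_liftHom_eq hsplit hext ▸ hpull U (coverPullback Ψ ι σ) (isAdmissible_comp _ hσadm)
  exact ⟨α, ξ, hα, fun _ => rfl, continuous_of_isSmooth_twist hπ.admissible.smooth hadm.smooth,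
    ⟨isIrreducible_twist hπ.irreducible ξ, hadm⟩, hext⟩

end

end LocalTheta

theorem proposition2p1
    -- the quadratic extension `E / F` of `p`-adic fields, `p ≠ 2`, with conjugation `τ`
    {p : ℕ} [Fact p.Prime] (hp : p ≠ 2)
    {F : Type*} [Field F] [Algebra ℚ_[p] F] [FiniteDimensional ℚ_[p] F]
    [TopologicalSpace F] [IsModuleTopology ℚ_[p] F]
    {E : Type*} [Field E] [Algebra F E] (hE : Module.finrank F E = 2)
    [TopologicalSpace E] [IsModuleTopology F E]
    (τ : E ≃ₐ[F] E) (hτ : τ ≠ 1)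
    -- the additive character `ψ`
    (ψ : AddChar F Circle) (hψc : Continuous ψ) (hψ : ψ ≠ 1)
    -- the `ε`-hermitian space `V` and the `ε'`-hermitian space `V'`
    {ε ε' : ℤˣ} (hε : ε * ε' = -1)
    {V : Type*} [AddCommGroup V] [Module E V] [FiniteDimensional E V]
    [Module F V] [IsScalarTower F E V]
    (h : V →ₛₗ[(τ : E →+* E)] V →ₗ[E] E) (hh : IsHermitian τ ε (fun v w => h v w))
    {V' : Type*} [AddCommGroup V'] [Module E V'] [FiniteDimensional E V']
    (h' : V' →ₗ[E] V' →ₛₗ[(τ : E →+* E)] E) (hh' : IsHermitian τ ε' (fun v w => h' v w))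
    -- two models of `ρ_ψ` with operators `M_g`, and an isomorphism between the models
    {SY : Type*} [AddCommGroup SY] [Module ℂ SY]
    (ρY : Representation ℂ
      (Heisenberg (dualPairForm (F := F) h h' (involution_of_quadratic hE τ))) SY)
    (hρY : IsHeisenbergModel ψ ρY) (MY : OperatorChoice ρY)
    {SB : Type*} [AddCommGroup SB] [Module ℂ SB]
    (ρB : Representation ℂ
      (Heisenberg (dualPairForm (F := F) h h' (involution_of_quadratic hE τ))) SB)
    (hρB : IsHeisenbergModel ψ ρB) (MB : OperatorChoice ρB)
    (Ψ : Representation.Equiv ρY ρB)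
    -- admissible splittings over `U(V)` and `U(V')` for the model `Y` and for the model `B`
    (βYV' : UnitaryGroup E (fun v w => h v w) → ℂˣ)
    (hβYV' : IsAdmissibleSplitting.{u} MY (embLeft h h' (involution_of_quadratic hE τ)) βYV')
    (βYV : UnitaryGroup E (fun v w => h' v w) → ℂˣ)
    (hβYV : IsAdmissibleSplitting.{u} MY (embRight h h' (involution_of_quadratic hE τ)) βYV)
    (βLV' : UnitaryGroup E (fun v w => h v w) → ℂˣ)
    (hβLV' : IsAdmissibleSplitting.{u} MB (embLeft h h' (involution_of_quadratic hE τ)) βLV')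
    (βLV : UnitaryGroup E (fun v w => h' v w) → ℂˣ)
    (hβLV : IsAdmissibleSplitting.{u} MB (embRight h h' (involution_of_quadratic hE τ)) βLV)
    -- representations related with respect to the splittings for the model `B`
    {U : Type u} [AddCommGroup U] [Module ℂ U]
    (π : Representation ℂ (UnitaryGroup E (fun v w => h v w)) U)
    {U' : Type u} [AddCommGroup U'] [Module ℂ U']
    (π' : Representation ℂ (UnitaryGroup E (fun v w => h' v w)) U')
    (hπ : IsIrreducibleAdmissible π) (hπ' : IsIrreducibleAdmissible π')
    (hrel : ThetaRelated MB (embLeft h h' (involution_of_quadratic hE τ))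
      (embRight h h' (involution_of_quadratic hE τ)) βLV' βLV π π') :
    ∃ (αV' : UnitaryGroup E (fun v w => h v w) → ℂˣ)
      (αV : UnitaryGroup E (fun v w => h' v w) → ℂˣ)
      (ξV' : UnitaryGroup E (fun v w => h v w) →* ℂˣ)
      (ξV : UnitaryGroup E (fun v w => h' v w) →* ℂˣ),
      IsComparison MY MB Ψ (embLeft h h' (involution_of_quadratic hE τ)) αV' ∧
      IsComparison MY MB Ψ (embRight h h' (involution_of_quadratic hE τ)) αV ∧
      (∀ g, ξV' g = αV' g * βYV' g * (βLV' g)⁻¹) ∧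
      (∀ g, ξV g = αV g * βYV g * (βLV g)⁻¹) ∧
      Continuous ξV' ∧ Continuous ξV ∧
      ThetaRelated MY (embLeft h h' (involution_of_quadratic hE τ))
        (embRight h h' (involution_of_quadratic hE τ)) βYV' βYV
        (twist π ξV') (twist π' ξV) := by
  have : IsTopologicalRing F := IsModuleTopology.isTopologicalRing ℚ_[p] F
  have : TopologicalSpace.SeparableSpace F := separableSpace_of_isModuleTopology ℚ_[p] F
  have : FiniteDimensional F E := Module.finite_of_finrank_pos (by omega)
  have : FiniteDimensional F (V ⊗[E] V') := Module.Finite.trans E _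
  have := Heisenberg.separableSpace (dualPairForm (F := F) h h' (involution_of_quadratic hE τ))
  have hS : Module.rank ℂ SB ≤ Cardinal.aleph0 :=
    rank_le_aleph0_of_smooth hρB.irreducible hρB.smooth
  obtain ⟨-, -, σ, σ', hσ, hσ', hθ⟩ := hrel
  obtain ⟨αV', ξV', h₁, h₂, h₃, h₄, h₅⟩ := exists_ratio_character hρB.irreducible hS Ψ hβYV'
    hβLV'.1 hπ hσ hθ.1.admissible
  obtain ⟨αV, ξV, k₁, k₂, k₃, k₄, k₅⟩ := exists_ratio_character hρB.irreducible hS Ψ hβYV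
    hβLV.1 hπ' hσ' hθ.2.1.admissible
  exact ⟨αV', αV, ξV', ξV, h₁, k₁, h₂, k₂, h₃, k₃, h₄, k₄, _, _, h₅, k₅,
    thetaCorrespond_coverPullback Ψ _ _ hθ⟩
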